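/- Let $k,m\ge 0$ be integers, let $\mathcal M_n$ denote the algebra of complex $n\times n$ matrices, and identify $\mathcal M_k\otimes\mathcal M_m$ with $\mathcal M_{km}$ through the Kronecker product. A (non-normalized) state of $\mathcal M_k\otimes\mathcal M_m$ is a positive semidefinite Hermitian matrix in $\mathcal M_k\otimes\mathcal M_m$. For $\gamma=\sum_{i=1}^n A_i\otimes B_i\in\mathcal M_k\otimes\mathcal M_m$ define the linear maps $G_\gamma:\mathcal M_k\to\mathcal M_m$, $G_\gamma(X)=\sum_i \operatorname{tr}(A_iX)B_i$, and $F_\gamma:\mathcal M_m\to\mathcal M_k$, $F_\gamma(Y)=\sum_i \operatorname{tr}(B_iY)A_i$. A linear map $T:\mathcal M_k\to\mathcal M_k$ that is positive (it maps positive semidefinite Hermitian matrices to positive semidefinite Hermitian matrices) and self-adjoint for the trace inner product $\langle X,Y\rangle=\operatorname{tr}(XY^*)$ is called completely reducible if there are orthogonal projections $W_1,\dots,W_l\in\mathcal M_k$ ($l\ge 0$) with $W_iW_j=0$ for $i\ne j$ such that: $T(W_i\mathcal M_kW_i)\subset W_i\mathcal M_kW_i$ for every $i$; $T|_{W_i\mathcal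 M_kW_i}$ is irreducible for every $i$, that is, if $W$ is an orthogonal projection with $W\mathcal M_kW\subset W_i\mathcal M_kW_i$ and $T(W\mathcal M_kW)\subset W\mathcal M_kW$, then $W=0$ or $W=W_i$; and $T$ vanishes on the orthogonal complement $R$ of $\bigoplus_i W_i\mathcal M_kW_i$ in $\mathcal M_k$ with respect to the trace inner product. Let $CR_{k,m}$ be the set of states $\gamma$ of $\mathcal M_k\otimes\mathcal M_m$ such that $F_\gamma\circ G_\gamma:\mathcal M_k\to\mathcal M_k$ is completely reducible. Then every positive definite matrix in $\mathcal M_k\otimes\mathcal M_m$ belongs to $CR_{k,m}$. In particular, $CR_{k,m}$ is dense in the set of states of $\mathcal M_k\otimes\mathcal M_m$. Moreover, if $k\ge 2$ and $m\ge 2$, then $CR_{k,m}$ is not closed. -/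

import Mathlib

open scoped ComplexOrder Kronecker

namespace CRStates

/-- The set `V M_n V = {V X V : X ∈ M_n}`, as a subspace of `M_n`. -/
def corner {n : ℕ} (V : Matrix (Fin n) (Fin n) ℂ) :
    Submodule ℂ (Matrix (Fin n) (Fin n) ℂ) where
  carrier := {Y | ∃ X : Matrix (Fin n) (Fin n) ℂ, Y = V * X * V}
  zero_mem' := ⟨0, by simp⟩
  add_mem' := by
    rintro _ _ ⟨X, rfl⟩ ⟨Y, rfl⟩
    exact ⟨X + Y, by rw [mul_add, add_mul]⟩
  smul_mem' := by
    rintro c _ ⟨X, rfl⟩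
    exact ⟨c • X, by simp⟩

/-- The linear map `T` leaves the subspace `S` invariant. -/
def LeavesInvariant {n : ℕ}
    (T : Matrix (Fin n) (Fin n) ℂ →ₗ[ℂ] Matrix (Fin n) (Fin n) ℂ)
    (S : Submodule ℂ (Matrix (Fin n) (Fin n) ℂ)) : Prop :=
  ∀ X ∈ S, T X ∈ S

/-- `T` sends positive semidefinite Hermitian matrices to positive semidefinite Hermitian
matrices. -/
def IsPositiveMap {n : ℕ}
    (T : Matrix (Fin n) (Fin n) ℂ →ₗ[ℂ] Matrix (Fin n) (Fin n) ℂ) : Prop :=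
  ∀ X : Matrix (Fin n) (Fin n) ℂ, X.PosSemidef → (T X).PosSemidef

/-- `T` is self-adjoint for the trace inner product `⟨X, Y⟩ = tr (X Y*)`. -/
def IsTraceSelfAdjoint {n : ℕ}
    (T : Matrix (Fin n) (Fin n) ℂ →ₗ[ℂ] Matrix (Fin n) (Fin n) ℂ) : Prop :=
  ∀ X Y : Matrix (Fin n) (Fin n) ℂ,
    (T X * Y.conjTranspose).trace = (X * (T Y).conjTranspose).trace

/-- Irreducibility of the restriction of `T` to `V M_n V` (which `T` is supposed to leave
invariant): the only sub-algebras `W M_n W` of `V M_n V`, with `W` an orthogonal projection, that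
are left invariant by `T` have `W = 0` or `W = V`. -/
def IsIrreducibleOn {n : ℕ}
    (T : Matrix (Fin n) (Fin n) ℂ →ₗ[ℂ] Matrix (Fin n) (Fin n) ℂ)
    (V : Matrix (Fin n) (Fin n) ℂ) : Prop :=
  ∀ W : Matrix (Fin n) (Fin n) ℂ, IsStarProjection W → corner W ≤ corner V →
    LeavesInvariant T (corner W) → W = 0 ∨ W = V

/-- The orthogonal complement, in `M_n` with the trace inner product, of the sum of the
sub-algebras `W i M_n W i`. -/
def orthoComplement {n l : ℕ} (W : Fin l → Matrix (Fin n) (Fin n) ℂ) :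
    Set (Matrix (Fin n) (Fin n) ℂ) :=
  {X | ∀ i, ∀ Y ∈ corner (W i), (X * Y.conjTranspose).trace = 0}

/-- A self-adjoint positive map `T : M_n → M_n` is completely reducible: there are mutually
orthogonal orthogonal projections `W 1, …, W l` such that `T` leaves each `W i M_n W i` invariant,
is irreducible on it, and vanishes on the orthogonal complement `R` of `⨁ i, W i M_n W i`.

The `W i M_n W i` are mutually orthogonal because `W i * W j = 0` for `i ≠ j`, and `R` is the
orthogonal complement of their sum, so `M_n = (⨁ i, W i M_n W i) ⊕ R` holds automatically. -/
structure IsCompletelyReducible {n : ℕ}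
    (T : Matrix (Fin n) (Fin n) ℂ →ₗ[ℂ] Matrix (Fin n) (Fin n) ℂ) : Prop where
  positive : IsPositiveMap T
  selfAdjoint : IsTraceSelfAdjoint T
  exists_decomposition : ∃ (l : ℕ) (W : Fin l → Matrix (Fin n) (Fin n) ℂ),
    (∀ i, IsStarProjection (W i)) ∧
    (∀ i j, i ≠ j → W i * W j = 0) ∧
    (∀ i, LeavesInvariant T (corner (W i))) ∧
    (∀ i, IsIrreducibleOn T (W i)) ∧
    ∀ X ∈ orthoComplement W, T X = 0

/-- `M_k ⊗ M_m`, identified with the matrices indexed by `Fin k × Fin m` through the Kronecker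
product. -/
abbrev BipartiteMatrix (k m : ℕ) : Type :=
  Matrix (Fin k × Fin m) (Fin k × Fin m) ℂ

/-- The map `G_γ : M_k → M_m`, `G_γ X = ∑ i, tr (A i X) B i` for `γ = ∑ i, A i ⊗ B i`, written out
in coordinates; see `mapG_sum_kronecker`. -/
def mapG {k m : ℕ} (γ : BipartiteMatrix k m) :
    Matrix (Fin k) (Fin k) ℂ →ₗ[ℂ] Matrix (Fin m) (Fin m) ℂ where
  toFun X := Matrix.of fun b b' => ∑ a, ∑ a', γ (a, b) (a', b') * X a' a
  map_add' X Y := by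
    ext b b'
    simp [mul_add, Finset.sum_add_distrib]
  map_smul' c X := by
    ext b b'
    simp [Finset.mul_sum, mul_left_comm]

/-- The map `F_γ : M_m → M_k`, `F_γ Y = ∑ i, tr (B i Y) A i` for `γ = ∑ i, A i ⊗ B i`, written out
in coordinates; see `mapF_sum_kronecker`. -/
def mapF {k m : ℕ} (γ : BipartiteMatrix k m) :
    Matrix (Fin m) (Fin m) ℂ →ₗ[ℂ] Matrix (Fin k) (Fin k) ℂ where
  toFun Y := Matrix.of fun a a' => ∑ b, ∑ b', γ (a, b) (a', b') * Y b' b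
  map_add' X Y := by
    ext a a'
    simp [mul_add, Finset.sum_add_distrib]
  map_smul' c X := by
    ext a a'
    simp [Finset.mul_sum, mul_left_comm]

theorem mapG_sum_kronecker {k m n : ℕ} (A : Fin n → Matrix (Fin k) (Fin k) ℂ)
    (B : Fin n → Matrix (Fin m) (Fin m) ℂ) (X : Matrix (Fin k) (Fin k) ℂ) :
    mapG (∑ i, A i ⊗ₖ B i) X = ∑ i, (A i * X).trace • B i := by
  ext b b'
  simp only [mapG, LinearMap.coe_mk, AddHom.coe_mk, Matrix.of_apply, Matrix.sum_apply,
    Matrix.kroneckerMap_apply, Matrix.smul_apply, smul_eq_mul, Matrix.trace, Matrix.diag_apply,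
    Matrix.mul_apply, Finset.sum_mul]
  conv_rhs => rw [Finset.sum_comm]; enter [2, a]; rw [Finset.sum_comm]
  exact Finset.sum_congr rfl fun a _ => Finset.sum_congr rfl fun a' _ =>
    Finset.sum_congr rfl fun i _ => by ring

theorem mapF_sum_kronecker {k m n : ℕ} (A : Fin n → Matrix (Fin k) (Fin k) ℂ)
    (B : Fin n → Matrix (Fin m) (Fin m) ℂ) (Y : Matrix (Fin m) (Fin m) ℂ) :
    mapF (∑ i, A i ⊗ₖ B i) Y = ∑ i, (B i * Y).trace • A i := by
  ext a a'
  simp only [mapF, LinearMap.coe_mk, AddHom.coe_mk, Matrix.of_apply, Matrix.sum_apply,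
    Matrix.kroneckerMap_apply, Matrix.smul_apply, smul_eq_mul, Matrix.trace, Matrix.diag_apply,
    Matrix.mul_apply, Finset.sum_mul]
  conv_rhs => rw [Finset.sum_comm]; enter [2, b]; rw [Finset.sum_comm]
  exact Finset.sum_congr rfl fun b _ => Finset.sum_congr rfl fun b' _ =>
    Finset.sum_congr rfl fun i _ => by ring

/-- The (non-normalized) states of `M_k ⊗ M_m`: the positive semidefinite Hermitian matrices. -/
def states (k m : ℕ) : Set (BipartiteMatrix k m) :=
  {γ | γ.PosSemidef}

/-- The set `CR_{k,m}` of completely reducible states of `M_k ⊗ M_m`. -/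
def CR (k m : ℕ) : Set (BipartiteMatrix k m) :=
  {γ | γ ∈ states k m ∧ IsCompletelyReducible (mapF γ ∘ₗ mapG γ)}

end CRStates

/-! If `γ` is positive definite, `G_γ` and `F_γ` both send nonzero positive semidefinite matrices to
positive definite ones (`posDef_mapG`). An invariant corner of `W ≠ 0` then contains an invertible
matrix, so `W = 1`, and the single block `1` is a decomposition. Density follows by adding `ε • 1`.

Were `CR` closed, density would make it contain every state. But for the pure state of `e₀ ⊗ e₀ + e₁
⊗ e₁`, `F_γ ∘ G_γ` is `X ↦ P X P` with `P` of rank two. It fixes `P M P` pointwise, so irreducible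
blocks can only contribute scalars; a decomposition would make `P M P` a span of orthogonal
projections, with no nonzero nilpotent (`not_isCompletelyReducible_compression`). -/

namespace CRStates

open Matrix

/-! ### Corners and irreducible blocks -/

section Corner

variable {n : ℕ}

theorem mul_mem_corner {V Y : Matrix (Fin n) (Fin n) ℂ} (hV : V * V = V) (hY : Y ∈ corner V) :
    V * Y = Y ∧ Y * V = Y := by
  obtain ⟨X, rfl⟩ := hY
  constructor
  · rw [← mul_assoc, ← mul_assoc, hV]
  · rw [mul_assoc, hV]

/-- A projection whose corner lies in the fixed points of `T` and on which `T` is irreducible has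
rank at most one. -/
theorem IsIrreducibleOn.exists_eq_smul
    {T : Matrix (Fin n) (Fin n) ℂ →ₗ[ℂ] Matrix (Fin n) (Fin n) ℂ}
    {W : Matrix (Fin n) (Fin n) ℂ} (hW : IsStarProjection W) (hirr : IsIrreducibleOn T W)
    (hT : ∀ X ∈ corner W, T X = X) (X : Matrix (Fin n) (Fin n) ℂ) :
    ∃ c : ℂ, W * X * W = c • W := by
  have hWW : W * W = W := hW.isIdempotentElem
  have hWs : Wᴴ = W := hW.isSelfAdjoint
  by_cases h0 : W = 0
  · exact ⟨0, by simp [h0]⟩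
  obtain ⟨j, hj⟩ : ∃ j, W j j ≠ 0 := by
    by_contra! h
    apply h0
    rw [← trace_conjTranspose_mul_self_eq_zero_iff, hWs, hWW]
    exact Finset.sum_eq_zero fun j _ => h j
  set E : Matrix (Fin n) (Fin n) ℂ := single j j 1 with hE
  have hEXE (X : Matrix (Fin n) (Fin n) ℂ) : E * X * E = X j j • E := by
    rw [hE, single_mul_mul_single]
    simp
  have hEs : Eᴴ = E := by simp [hE]
  have hjs : star (W j j) = W j j := by
    conv_rhs => rw [← hWs]
    simp
  -- The rank-one projection onto the span of `W e_j`; its corner is fixed by `T`, so irreducibility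
  -- will force `p = W`.
  set p : Matrix (Fin n) (Fin n) ℂ := (W j j)⁻¹ • (W * E * W) with hp
  have key (X : Matrix (Fin n) (Fin n) ℂ) :
      (W * E * W) * X * (W * E * W) = (W * X * W) j j • (W * E * W) := by
    calc (W * E * W) * X * (W * E * W) = W * (E * (W * X * W) * E) * W := by noncomm_ring
      _ = _ := by rw [hEXE]; simp
  have hpp : p * p = p := by
    have h1 := key 1
    rw [mul_one, mul_one, hWW] at h1
    rw [hp, smul_mul_smul_comm, h1, smul_smul]
    congr 1
    field_simp
  have hps : IsStarProjection p := by
    refine ⟨hpp, ?_⟩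
    change pᴴ = p
    rw [hp, conjTranspose_smul, conjTranspose_mul, conjTranspose_mul, hWs, hEs, star_inv₀, hjs,
      mul_assoc]
  have hle : corner p ≤ corner W := by
    rintro _ ⟨X, rfl⟩
    refine ⟨p * X * p, ?_⟩
    have h1 : W * p = p := by rw [hp, mul_smul_comm, ← mul_assoc, ← mul_assoc, hWW]
    have h2 : p * W = p := by rw [hp, smul_mul_assoc, mul_assoc, hWW]
    calc p * X * p = (W * p) * X * (p * W) := by rw [h1, h2]
      _ = _ := by noncomm_ring
  rcases hirr p hps hle (fun X hX => by rwa [hT X (hle hX)]) with h | h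
  · exfalso
    rw [hp, smul_eq_zero, inv_eq_zero, or_iff_right hj] at h
    have h1 := hEXE W
    apply hj
    have h2 : E * W * (W * E * W) * W * E = (W j j * W j j) • E := by
      calc E * W * (W * E * W) * W * E = (E * (W * W) * E) * ((W * W) * E) := by noncomm_ring
        _ = _ := by rw [hWW, h1, smul_mul_assoc, ← mul_assoc, h1, smul_smul]
    rw [h] at h2
    have h3 := congrFun (congrFun h2 j) j
    simpa [hE] using h3
  · have h1 : W * E * W = W j j • W := by
      calc W * E * W = W j j • p := by rw [hp, smul_smul, mul_inv_cancel₀ hj, one_smul]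
        _ = _ := by rw [h]
    have h2 := key X
    rw [h1, smul_mul_assoc, smul_mul_smul_comm, smul_smul] at h2
    refine ⟨(W j j * W j j)⁻¹ * ((W * X * W) j j * W j j), ?_⟩
    rw [mul_smul, ← h2, smul_smul, inv_mul_cancel₀ (mul_ne_zero hj hj), one_smul]

/-- Compression by `W j` kills every other block. A map vanishing on the complement is thus
determined by the compressions `W i * X * W i`. -/
theorem sub_sum_corner_mem_orthoComplement {l : ℕ} {W : Fin l → Matrix (Fin n) (Fin n) ℂ}
    (hW : ∀ i, IsStarProjection (W i)) (hWW : ∀ i j, i ≠ j → W i * W j = 0)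
    (X : Matrix (Fin n) (Fin n) ℂ) :
    X - ∑ i, W i * X * W i ∈ orthoComplement W := by
  rintro j _ ⟨Z, rfl⟩
  have hs : (W j)ᴴ = W j := (hW j).isSelfAdjoint
  have hj : W j * W j = W j := (hW j).isIdempotentElem
  have hsum : W j * (∑ i, W i * X * W i) * W j = W j * X * W j := by
    rw [Finset.mul_sum, Finset.sum_mul, Finset.sum_eq_single j]
    · calc W j * (W j * X * W j) * W j = (W j * W j) * X * (W j * W j) := by noncomm_ring
        _ = _ := by rw [hj]
    · intro i _ hi
      rw [← mul_assoc, ← mul_assoc, hWW j i hi.symm]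
      simp
    · simp
  rw [conjTranspose_mul, conjTranspose_mul, hs, ← mul_assoc, ← mul_assoc, trace_mul_comm,
    ← mul_assoc, ← mul_assoc, mul_sub, sub_mul, hsum, sub_self, zero_mul, trace_zero]

/-- A compression `X ↦ P X P` to a corner that contains a nonzero square-zero matrix is not
completely reducible. -/
theorem not_isCompletelyReducible_compression
    {T : Matrix (Fin n) (Fin n) ℂ →ₗ[ℂ] Matrix (Fin n) (Fin n) ℂ}
    {P N : Matrix (Fin n) (Fin n) ℂ} (hP : IsStarProjection P) (hT : ∀ X, T X = P * X * P)
    (hPN : P * N = N) (hNP : N * P = N) (hN : N * N = 0) (hN0 : N ≠ 0) :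
    ¬ IsCompletelyReducible T := by
  rintro ⟨-, -, l, W, hW, horth, hinv, hirr, hR⟩
  have hPP : P * P = P := hP.isIdempotentElem
  have hPs : Pᴴ = P := hP.isSelfAdjoint
  have hWW (i) : W i * W i = W i := (hW i).isIdempotentElem
  have hWs (i) : (W i)ᴴ = W i := (hW i).isSelfAdjoint
  have hcomm (i) : P * W i = W i * P := by
    have h1 : T (W i) ∈ corner (W i) := hinv i _ ⟨W i, by rw [hWW, hWW]⟩
    have h2 := (mul_mem_corner (hWW i) h1).1
    rw [hT] at h2
    -- Invariance puts `P W P` in the corner of `W`, so `(1 - W) P W P (1 - W) = 0`, which has the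
    -- form `A* A`.
    have h3 : W i * P * (1 - W i) = 0 := by
      rw [← conjTranspose_mul_self_eq_zero]
      simp only [conjTranspose_mul, conjTranspose_sub, conjTranspose_one, hWs, hPs]
      calc (1 - W i) * (P * W i) * (W i * P * (1 - W i))
          = (P * (W i * W i) * P - W i * (P * (W i * W i) * P)) * (1 - W i) := by noncomm_ring
        _ = 0 := by rw [hWW, h2, sub_self, zero_mul]
    have h4 : W i * P = W i * P * W i := by
      rwa [mul_sub, mul_one, sub_eq_zero] at h3
    have h5 := congrArg conjTranspose h4
    simp only [conjTranspose_mul, hWs, hPs] at h5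
    rw [h5, h4, mul_assoc]
  have hterm (i) : ∃ c : ℂ, P * (W i * N * W i) * P = c • (W i * P) := by
    have hQ : IsStarProjection (W i * P) := by
      constructor
      · change W i * P * (W i * P) = W i * P
        rw [mul_assoc, ← mul_assoc P, hcomm, mul_assoc (W i) P, hPP, ← mul_assoc, hWW]
      · change (W i * P)ᴴ = W i * P
        rw [conjTranspose_mul, hWs, hPs, hcomm]
    have hle : corner (W i * P) ≤ corner (W i) := by
      rintro _ ⟨X, rfl⟩
      refine ⟨P * X * P, ?_⟩
      calc W i * P * X * (W i * P) = W i * P * X * (P * W i) := by rw [hcomm]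
        _ = _ := by noncomm_ring
    have hfix : ∀ X ∈ corner (W i * P), T X = X := by
      rintro _ ⟨X, rfl⟩
      rw [hT]
      calc P * (W i * P * X * (W i * P)) * P = (P * W i) * P * X * (W i * (P * P)) := by
            noncomm_ring
        _ = _ := by rw [hcomm, hPP, mul_assoc (W i) P P, hPP]
    -- Either the block misses the range of `P`, or it lies inside it, where `T` is the identity and
    -- the block has rank at most one.
    rcases hirr i _ hQ hle (fun X hX => by rwa [hfix X hX]) with h | h
    · refine ⟨0, ?_⟩
      have h1 : W i * N = 0 := by rw [← hPN, ← mul_assoc, h, zero_mul]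
      rw [h1]
      simp
    · rw [h] at hfix
      obtain ⟨c, hc⟩ := (hirr i).exists_eq_smul (hW i) hfix N
      refine ⟨c, ?_⟩
      rw [hc, mul_smul_comm, smul_mul_assoc, hcomm, mul_assoc, hPP]
  choose c hc using hterm
  have hNsum : N = ∑ i, c i • (W i * P) := by
    have h1 := hR _ (sub_sum_corner_mem_orthoComplement hW horth N)
    rw [hT, mul_sub, sub_mul, hPN, hNP, sub_eq_zero, Finset.mul_sum, Finset.sum_mul] at h1
    rw [h1]
    exact Finset.sum_congr rfl fun i _ => hc i
  have hNQ (j) : N * (W j * P) = c j • (W j * P) := by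
    rw [hNsum, Finset.sum_mul, Finset.sum_eq_single j]
    · rw [smul_mul_assoc]
      congr 1
      rw [mul_assoc, ← mul_assoc P, hcomm, mul_assoc (W j) P, hPP, ← mul_assoc, hWW]
    · intro i _ hi
      rw [smul_mul_assoc, mul_assoc, ← mul_assoc P, hcomm, mul_assoc (W j) P, ← mul_assoc,
        horth i j hi, zero_mul, smul_zero]
    · simp
  apply hN0
  rw [hNsum]
  refine Finset.sum_eq_zero fun j _ => ?_
  have h1 : (c j * c j) • (W j * P) = 0 := by
    rw [mul_smul, ← hNQ j, ← mul_smul_comm, ← hNQ j, ← mul_assoc, hN, zero_mul]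
  rcases smul_eq_zero.mp h1 with h | h
  · rw [mul_self_eq_zero.mp h, zero_smul]
  · rw [h, smul_zero]

/-- A positivity-improving self-adjoint map is irreducible, hence completely reducible. -/
theorem isCompletelyReducible_of_posDef [NeZero n]
    {T : Matrix (Fin n) (Fin n) ℂ →ₗ[ℂ] Matrix (Fin n) (Fin n) ℂ}
    (hpos : IsPositiveMap T) (hsa : IsTraceSelfAdjoint T)
    (hT : ∀ X : Matrix (Fin n) (Fin n) ℂ, X.PosSemidef → X ≠ 0 → (T X).PosDef) :
    IsCompletelyReducible T := by
  refine ⟨hpos, hsa, 1, fun _ => 1, fun _ => .one _, fun i j h => (h (Subsingleton.elim i j)).elim,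
    fun _ X _ => ⟨T X, by simp⟩, fun _ W hW _ hinv => ?_, fun X hX => ?_⟩
  · by_cases h0 : W = 0
    · exact .inl h0
    right
    have hWW : W * W = W := hW.isIdempotentElem
    have hWs : Wᴴ = W := hW.isSelfAdjoint
    have hps : W.PosSemidef := by
      have := posSemidef_conjTranspose_mul_self W
      rwa [hWs, hWW] at this
    -- Invariance gives `W * T W = T W`; cancel the invertible `T W`.
    have hu : IsUnit (T W) := (hT W hps h0).isUnit
    have h1 := (mul_mem_corner hWW (hinv W ⟨W, by rw [hWW, hWW]⟩)).1
    exact hu.mul_right_cancel (by rw [h1, one_mul])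
  · have h1 := hX 0 X ⟨X, by simp⟩
    rw [trace_mul_conjTranspose_self_eq_zero_iff] at h1
    rw [h1, map_zero]

end Corner

/-! ### Positivity of `F_γ` and `G_γ`, and density -/

section Bipartite

variable {k m : ℕ}

/-- The bipartite matrix with its two tensor factors exchanged. -/
def swap (γ : BipartiteMatrix k m) : BipartiteMatrix m k :=
  γ.submatrix Prod.swap Prod.swap

theorem mapF_eq_mapG_swap (γ : BipartiteMatrix k m) : mapF γ = mapG (swap γ) := rfl

theorem posSemidef_swap {γ : BipartiteMatrix k m} (hγ : γ.PosSemidef) : (swap γ).PosSemidef :=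
  hγ.submatrix _

theorem posDef_swap {γ : BipartiteMatrix k m} (hγ : γ.PosDef) : (swap γ).PosDef :=
  hγ.submatrix Prod.swap_injective

theorem conjTranspose_mapG {γ : BipartiteMatrix k m} (hγ : γ.IsHermitian)
    (X : Matrix (Fin k) (Fin k) ℂ) : (mapG γ X)ᴴ = mapG γ Xᴴ := by
  ext b b'
  simp only [mapG, LinearMap.coe_mk, AddHom.coe_mk, conjTranspose_apply, of_apply, star_sum,
    star_mul']
  rw [Finset.sum_comm]
  exact Finset.sum_congr rfl fun a _ => Finset.sum_congr rfl fun a' _ => by rw [hγ.apply]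

/-- Both sides equal `tr (γ (X ⊗ Y))`. -/
theorem trace_mapF_mul (γ : BipartiteMatrix k m) (Y : Matrix (Fin m) (Fin m) ℂ)
    (X : Matrix (Fin k) (Fin k) ℂ) : (mapF γ Y * X).trace = (Y * mapG γ X).trace := by
  rw [trace_mul_comm Y]
  simp only [mapF, mapG, LinearMap.coe_mk, AddHom.coe_mk, trace, diag_apply, mul_apply, of_apply,
    Finset.sum_mul]
  simp only [← Fintype.sum_prod_type']
  refine Fintype.sum_equiv
    ⟨fun x => (x.2.2.1, x.2.2.2, x.1, x.2.1), fun x => (x.2.2.1, x.2.2.2, x.1, x.2.1),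
      fun _ => rfl, fun _ => rfl⟩ _ _ fun x => ?_
  simp only [Equiv.coe_fn_mk]
  ring

theorem isTraceSelfAdjoint_comp {γ : BipartiteMatrix k m} (hγ : γ.PosSemidef) :
    IsTraceSelfAdjoint (mapF γ ∘ₗ mapG γ) := by
  intro X Y
  rw [LinearMap.comp_apply, LinearMap.comp_apply, mapF_eq_mapG_swap,
    conjTranspose_mapG (posSemidef_swap hγ).1, conjTranspose_mapG hγ.1, ← mapF_eq_mapG_swap,
    trace_mapF_mul, trace_mul_comm X, trace_mapF_mul, trace_mul_comm]

/-- Reduces positivity of `G_γ` to that of `γ` on product vectors, one for each row of `B`. -/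
theorem dotProduct_mapG_mulVec (γ : BipartiteMatrix k m) (B : Matrix (Fin k) (Fin k) ℂ)
    (y : Fin m → ℂ) :
    star y ⬝ᵥ (mapG γ (Bᴴ * B) *ᵥ y) =
      ∑ c, star (fun p : Fin k × Fin m => star (B c p.1) * y p.2) ⬝ᵥ
        (γ *ᵥ fun p : Fin k × Fin m => star (B c p.1) * y p.2) := by
  simp only [mapG, LinearMap.coe_mk, AddHom.coe_mk, dotProduct, mulVec, of_apply, mul_apply,
    conjTranspose_apply, Pi.star_apply, Finset.sum_mul, Finset.mul_sum, Fintype.sum_prod_type,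
    star_mul', star_star]
  simp only [← Fintype.sum_prod_type']
  refine Fintype.sum_equiv
    ⟨fun x => (x.2.2.2.2, x.2.2.1, x.1, x.2.2.2.1, x.2.1),
      fun x => (x.2.2.1, x.2.2.2.2, x.2.1, x.2.2.2.1, x.1),
      fun _ => rfl, fun _ => rfl⟩ _ _ fun x => ?_
  simp only [Equiv.coe_fn_mk]
  ring

theorem exists_eq_conjTranspose_mul_self {X : Matrix (Fin k) (Fin k) ℂ} (hX : X.PosSemidef) :
    ∃ B : Matrix (Fin k) (Fin k) ℂ, X = Bᴴ * B := by
  open scoped MatrixOrder in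
  exact CStarAlgebra.nonneg_iff_eq_star_mul_self.mp hX.nonneg

theorem posSemidef_mapG {γ : BipartiteMatrix k m} (hγ : γ.PosSemidef)
    {X : Matrix (Fin k) (Fin k) ℂ} (hX : X.PosSemidef) : (mapG γ X).PosSemidef := by
  refine .of_dotProduct_mulVec_nonneg ?_ fun y => ?_
  · rw [IsHermitian, conjTranspose_mapG hγ.1, hX.1]
  · obtain ⟨B, rfl⟩ := exists_eq_conjTranspose_mul_self hX
    rw [dotProduct_mapG_mulVec]
    exact Finset.sum_nonneg fun c _ => hγ.dotProduct_mulVec_nonneg _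

theorem posDef_mapG {γ : BipartiteMatrix k m} (hγ : γ.PosDef)
    {X : Matrix (Fin k) (Fin k) ℂ} (hX : X.PosSemidef) (hX0 : X ≠ 0) : (mapG γ X).PosDef := by
  refine .of_dotProduct_mulVec_pos (posSemidef_mapG hγ.posSemidef hX).1 fun y hy => ?_
  obtain ⟨B, rfl⟩ := exists_eq_conjTranspose_mul_self hX
  rw [dotProduct_mapG_mulVec]
  obtain ⟨b, hb⟩ := Function.ne_iff.mp hy
  obtain ⟨c, a, hca⟩ : ∃ c a, B c a ≠ 0 := by
    by_contra! h
    apply hX0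
    rw [show B = 0 from Matrix.ext h, mul_zero]
  refine Finset.sum_pos' (fun c _ => hγ.posSemidef.dotProduct_mulVec_nonneg _)
    ⟨c, Finset.mem_univ c, hγ.dotProduct_mulVec_pos fun h => ?_⟩
  exact mul_ne_zero (star_ne_zero.mpr hca) hb (congrFun h (a, b))

theorem isPositiveMap_comp {γ : BipartiteMatrix k m} (hγ : γ.PosSemidef) :
    IsPositiveMap (mapF γ ∘ₗ mapG γ) := fun _ hX =>
  posSemidef_mapG (posSemidef_swap hγ) (posSemidef_mapG hγ hX)

theorem mem_CR_of_posDef {γ : BipartiteMatrix k m} (hγ : γ.PosDef) : γ ∈ CR k m := by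
  refine ⟨hγ.posSemidef, ?_⟩
  have hpos := isPositiveMap_comp hγ.posSemidef
  have hsa := isTraceSelfAdjoint_comp hγ.posSemidef
  rcases Nat.eq_zero_or_pos k with rfl | hk
  · exact ⟨hpos, hsa, 0, Fin.elim0, fun i => i.elim0, fun i => i.elim0, fun i => i.elim0,
      fun i => i.elim0, fun X _ => Subsingleton.elim _ _⟩
  -- For `m = 0` the composite is zero, hence not positivity improving; the empty family of blocks
  -- serves instead.
  rcases Nat.eq_zero_or_pos m with rfl | hm
  · refine ⟨hpos, hsa, 0, Fin.elim0, fun i => i.elim0, fun i => i.elim0, fun i => i.elim0,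
      fun i => i.elim0, fun X _ => ?_⟩
    rw [LinearMap.comp_apply, Subsingleton.elim (mapG γ X) 0, map_zero]
  have : NeZero k := ⟨hk.ne'⟩
  refine isCompletelyReducible_of_posDef hpos hsa fun X hX hX0 => ?_
  have hG := posDef_mapG hγ hX hX0
  refine posDef_mapG (posDef_swap hγ) hG.posSemidef fun h => ?_
  have hy : (Pi.single ⟨0, hm⟩ 1 : Fin m → ℂ) ≠ 0 := by simp
  simpa [h] using hG.dotProduct_mulVec_pos hy

theorem states_subset_closure_CR : states k m ⊆ closure (CR k m) := by
  intro γ hγ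
  have hlim : Filter.Tendsto (fun N : ℕ => γ + ((1 / ((N : ℝ) + 1) : ℝ) : ℂ) • 1) Filter.atTop
      (nhds (γ + ((0 : ℝ) : ℂ) • (1 : BipartiteMatrix k m))) :=
    tendsto_const_nhds.add
      (((Complex.continuous_ofReal.tendsto 0).comp tendsto_one_div_add_atTop_nhds_zero_nat).smul_const
        1)
  rw [Complex.ofReal_zero, zero_smul, add_zero] at hlim
  refine mem_closure_of_tendsto hlim (.of_forall fun N => mem_CR_of_posDef ?_)
  refine Matrix.PosDef.posSemidef_add hγ (Matrix.PosDef.one.smul ?_)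
  exact_mod_cast (Nat.one_div_pos_of_nat : (0 : ℝ) < 1 / ((N : ℝ) + 1))

/-! ### A state outside `CR` -/

/-- The amplitudes of the unnormalized entangled vector `e₀ ⊗ e₀ + e₁ ⊗ e₁`. -/
def bellMatrix (k m : ℕ) : Matrix (Fin k) (Fin m) ℂ :=
  of fun a b => if a.val = b.val ∧ a.val < 2 then 1 else 0

theorem star_bellMatrix (a : Fin k) (b : Fin m) : star (bellMatrix k m a b) = bellMatrix k m a b := by
  simp only [bellMatrix, of_apply]
  split_ifs <;> simp

/-- The pure state of the vector `e₀ ⊗ e₀ + e₁ ⊗ e₁`. -/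
def bellState (k m : ℕ) : BipartiteMatrix k m :=
  vecMulVec (fun p => bellMatrix k m p.1 p.2) (star fun p => bellMatrix k m p.1 p.2)

theorem bellState_mem_states : bellState k m ∈ states k m :=
  posSemidef_vecMulVec_self_star _

theorem mapG_bellState (X : Matrix (Fin k) (Fin k) ℂ) :
    mapG (bellState k m) X = (bellMatrix k m)ᵀ * Xᵀ * bellMatrix k m := by
  ext b b'
  simp only [mapG, LinearMap.coe_mk, AddHom.coe_mk, of_apply, bellState, vecMulVec_apply,
    Pi.star_apply, star_bellMatrix, mul_apply, transpose_apply, Finset.sum_mul]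
  rw [Finset.sum_comm]
  exact Finset.sum_congr rfl fun a _ => Finset.sum_congr rfl fun a' _ => by ring

theorem mapF_bellState (Y : Matrix (Fin m) (Fin m) ℂ) :
    mapF (bellState k m) Y = bellMatrix k m * Yᵀ * (bellMatrix k m)ᵀ := by
  ext a a'
  simp only [mapF, LinearMap.coe_mk, AddHom.coe_mk, of_apply, bellState, vecMulVec_apply,
    Pi.star_apply, star_bellMatrix, mul_apply, transpose_apply, Finset.sum_mul]
  rw [Finset.sum_comm]
  exact Finset.sum_congr rfl fun b _ => Finset.sum_congr rfl fun b' _ => by ring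

/-- With `C` the amplitude matrix, the transposes in `F_γ` and `G_γ` cancel, leaving `X ↦ (C Cᵀ) X
(C Cᵀ)`; this identifies the compressing projection. -/
theorem bellMatrix_mul_transpose (hm : 2 ≤ m) :
    bellMatrix k m * (bellMatrix k m)ᵀ = diagonal fun a => if a.val < 2 then 1 else 0 := by
  ext a a'
  simp only [mul_apply, transpose_apply, bellMatrix, of_apply, diagonal_apply]
  by_cases ha : a.val < 2
  · rw [Finset.sum_eq_single (⟨a.val, ha.trans_le hm⟩ : Fin m)]
    · by_cases h : a = a'
      · simp [← h, ha]
      · have h' : ¬ a'.val = a.val := fun h1 => h (Fin.ext h1.symm)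
        simp [h, h']
    · intro b _ hb
      have h' : ¬ a.val = b.val := fun h1 => hb (Fin.ext h1.symm)
      simp [h']
    · simp
  · simp [ha]

theorem bellState_notMem_CR (hk : 2 ≤ k) (hm : 2 ≤ m) : bellState k m ∉ CR k m := by
  rintro ⟨-, h⟩
  set P : Matrix (Fin k) (Fin k) ℂ := diagonal fun a => if a.val < 2 then 1 else 0 with hPdef
  have hP : IsStarProjection P := by
    constructor
    · change P * P = P
      simp [hPdef]
    · change Pᴴ = P
      rw [hPdef, diagonal_conjTranspose]
      congr 1
      ext a
      simp only [Pi.star_apply]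
      split_ifs <;> simp
  let i0 : Fin k := ⟨0, by omega⟩
  let i1 : Fin k := ⟨1, by omega⟩
  have h01 : i1 ≠ i0 := by simp [i0, i1]
  refine not_isCompletelyReducible_compression (P := P) (N := single i0 i1 1) hP (fun X => ?_)
    ?_ ?_ ?_ ?_ h
  · rw [LinearMap.comp_apply, mapG_bellState, mapF_bellState, hPdef,
      ← bellMatrix_mul_transpose hm]
    simp only [transpose_mul, transpose_transpose]
    simp only [Matrix.mul_assoc]
  · ext a b
    by_cases ha : i0 = a
    · simp [hPdef, diagonal_mul, single_apply, ← ha, i0]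
    · simp [hPdef, diagonal_mul, ha]
  · ext a b
    by_cases hb : i1 = b
    · simp [hPdef, mul_diagonal, single_apply, ← hb, i1]
    · simp [hPdef, mul_diagonal, hb]
  · exact single_mul_single_of_ne _ _ _ _ h01 _
  · intro h0
    simpa using congrFun (congrFun h0 i0) i1

end Bipartite

end CRStates

theorem mainTheorem11 (k m : ℕ) :
    (∀ γ : CRStates.BipartiteMatrix k m, γ.PosDef → γ ∈ CRStates.CR k m) ∧
    (CRStates.CR k m ⊆ CRStates.states k m ∧
      CRStates.states k m ⊆ closure (CRStates.CR k m)) ∧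
    (2 ≤ k → 2 ≤ m → ¬ IsClosed (CRStates.CR k m)) := by
  refine ⟨fun γ hγ => CRStates.mem_CR_of_posDef hγ,
    ⟨fun γ hγ => hγ.1, CRStates.states_subset_closure_CR⟩, fun hk hm hcl => ?_⟩
  have h := CRStates.states_subset_closure_CR (CRStates.bellState_mem_states (k := k) (m := m))
  rw [hcl.closure_eq] at h
  exact CRStates.bellState_notMem_CR hk hm h
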